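/- Let $\mathcal P=\{q_\ell\colon M_\ell\to M_{\ell-1}\mid \ell\ge 1\}$ be a presentation, that is, a sequence of finite covering maps, where each $M_\ell$ is a compact connected (non-empty, Hausdorff) topological manifold without boundary and all $M_\ell$ have the same dimension $n$. Let $\bar q_\ell=q_1\circ\cdots\circ q_\ell\colon M_\ell\to M_0$, and let $$\mathcal M_{\mathcal P}=\varprojlim\{q_\ell\colon M_\ell\to M_{\ell-1}\}\subset\prod_{\ell\ge 0}M_\ell$$ be the associated solenoidal manifold, with the topology induced from the product topology. A Steinitz number is a formal product $\xi=\prod_p p^{\chi_\xi(p)}$ over all primes $p$, with $\chi_\xi(p)\in\{0,1,\dots,\infty\}$; Steinitz numbers are multiplied by adding exponents, a positive integer is a Steinitz number through its prime factorization, and the lcm of a set of positive integers is the Steinitz number whose exponent at $p$ is the supremum of the exponents of $p$ in its elements. The type $\tau[\xi]$ is the class of $\xi$ for the equivalence relation in which $\xi\sim\xi'$ if $m\cdot\xi=m'\cdot\xi'$ for some integers $m,m'\ge 1$. (1) The presentation $\mathcal P$ has a well-defined Steinitz number: for every $\ell\ge 1$ all fibers of $q_\ell$ have the same finite number $m_\ell\ge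 1$ of points, all fibers of $\bar q_\ell$ have $m_1m_2\cdots m_\ell$ points, and $$\xi(\mathcal P)=\operatorname{lcm}\{m_1m_2\cdots m_\ell\mid \ell>0\}.$$ Moreover, for every basepoint $x=(x_0,x_1,\dots)\in\mathcal M_{\mathcal P}$, the image $\Gamma_\ell$ of $\pi_1(M_\ell,x_\ell)$ in $\Gamma=\pi_1(M_0,x_0)$ under $(\bar q_\ell)_\#$ satisfies $[\Gamma:\Gamma_\ell]=m_1m_2\cdots m_\ell$, so that $\xi(\mathcal P)=\operatorname{lcm}\{[\Gamma:\Gamma_\ell]\mid \ell>0\}$, independently of $x$. (2) The type $\tau[\xi(\mathcal P)]$ depends only on the homeomorphism class of $\mathcal M_{\mathcal P}$: if $\mathcal P$ and $\mathcal P'$ are presentations (of manifolds of dimensions $n$ and $n'$) such that $\mathcal M_{\mathcal P}$ and $\mathcal M_{\mathcal P'}$ are homeomorphic, then $\tau[\xi(\mathcal P)]=\tau[\xi(\mathcal P')]$. -/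

import Mathlib

universe u v

/-! ### Steinitz (supernatural) numbers and their types -/

/-- A Steinitz number `∏ p ^ χ p`, a formal product over all primes, given by its characteristic
function `χ`, with values in `{0, 1, …, ∞}`. -/
@[ext]
structure SteinitzNumber where
  /-- The multiplicity with which each prime occurs. -/
  χ : Nat.Primes → ℕ∞

namespace SteinitzNumber

/-- The product of formal products: multiplicities are added. -/
instance : Mul SteinitzNumber := ⟨fun ξ η => ⟨fun p => ξ.χ p + η.χ p⟩⟩

theorem mul_χ (ξ η : SteinitzNumber) (p : Nat.Primes) : (ξ * η).χ p = ξ.χ p + η.χ p := rfl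

/-- A positive integer, regarded as a Steinitz number through its prime factorization. -/
noncomputable def ofNat (m : ℕ) : SteinitzNumber := ⟨fun p => emultiplicity (p : ℕ) m⟩

/-- The least common multiple of a set of positive integers, as a Steinitz number: the
multiplicity of `p` is the supremum of its multiplicities in the elements of the set. -/
noncomputable def lcm (S : Set ℕ) : SteinitzNumber := ⟨fun p => ⨆ m ∈ S, (ofNat m).χ p⟩

/-- Asymptotic equivalence: `m · ξ = m' · ξ'` for some integers `m, m' ≥ 1`. -/
def AsympEquiv (ξ ξ' : SteinitzNumber) : Prop :=
  ∃ m m' : ℕ, 1 ≤ m ∧ 1 ≤ m' ∧ ofNat m * ξ = ofNat m' * ξ'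

theorem ofNat_mul (a b : ℕ) : ofNat (a * b) = ofNat a * ofNat b := by
  ext p : 2
  exact emultiplicity_mul (Nat.prime_iff.mp p.2)

theorem asympEquiv_equivalence : Equivalence AsympEquiv where
  refl ξ := ⟨1, 1, le_rfl, le_rfl, rfl⟩
  symm := fun ⟨m, m', h, h', e⟩ => ⟨m', m, h', h, e.symm⟩
  trans := by
    rintro ξ η ζ ⟨m, m', h, h', e⟩ ⟨k, k', l, l', f⟩
    refine ⟨k * m, m' * k', Nat.mul_pos l h, Nat.mul_pos h' l', ?_⟩
    ext p : 2
    have e' := congrArg (fun s : SteinitzNumber => s.χ p) e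
    have f' := congrArg (fun s : SteinitzNumber => s.χ p) f
    simp only [ofNat_mul, mul_χ] at e' f' ⊢
    rw [add_assoc, e', add_left_comm, f', add_assoc]

/-- Asymptotic equivalence as a setoid. -/
def asympSetoid : Setoid SteinitzNumber := ⟨AsympEquiv, asympEquiv_equivalence⟩

/-- The type `τ[ξ]` of a Steinitz number: its asymptotic equivalence class. -/
def type (ξ : SteinitzNumber) : Quotient asympSetoid := Quotient.mk asympSetoid ξ

end SteinitzNumber

/-! ### Presentations and solenoidal manifolds -/

/-- A presentation: a sequence of finite covering maps `q l : M (l + 1) → M l` of compact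
connected topological manifolds without boundary, all of the same dimension `n`. -/
structure Presentation (n : ℕ) where
  /-- The manifolds. -/
  M : ℕ → Type u
  [topologicalSpace : ∀ l, TopologicalSpace (M l)]
  [t2Space : ∀ l, T2Space (M l)]
  [compactSpace : ∀ l, CompactSpace (M l)]
  [connectedSpace : ∀ l, ConnectedSpace (M l)]
  -- a second countability condition is automatic for a compact locally Euclidean space
  chartedSpace : ∀ l, Nonempty (ChartedSpace (EuclideanSpace ℝ (Fin n)) (M l))
  /-- The bonding maps. -/
  q : ∀ l, M (l + 1) → M l
  isCoveringMap_q : ∀ l, IsCoveringMap (q l)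
  finite_fiber_q : ∀ (l : ℕ) (y : M l), (q l ⁻¹' {y}).Finite

namespace Presentation

attribute [instance] topologicalSpace t2Space compactSpace connectedSpace

variable {n : ℕ} (P : Presentation.{u} n)

/-- The solenoidal manifold of a presentation: the inverse limit of the maps `q l`, with the
topology induced from the product topology. -/
def Solenoid : Type u := {x : ∀ l, P.M l // ∀ l, P.q l (x (l + 1)) = x l}

instance : TopologicalSpace P.Solenoid :=
  inferInstanceAs (TopologicalSpace {x : ∀ l, P.M l // ∀ l, P.q l (x (l + 1)) = x l})

/-- The composite covering map from `M l` to the base manifold `M 0`. -/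
def qbar : (l : ℕ) → P.M l → P.M 0
  | 0 => id
  | l + 1 => qbar l ∘ P.q l

theorem continuous_qbar : ∀ l, Continuous (P.qbar l)
  | 0 => continuous_id
  | l + 1 => (continuous_qbar l).comp (P.isCoveringMap_q l).continuous

theorem qbar_apply (x : P.Solenoid) : ∀ l, P.qbar l (x.1 l) = x.1 0
  | 0 => rfl
  | l + 1 => (congrArg (P.qbar l) (x.2 l)).trans (qbar_apply x l)

/-- The covering degree of `q l`: the number of points in the fiber over a chosen point. -/
noncomputable def degree (l : ℕ) : ℕ :=
  Nat.card (P.q l ⁻¹' {Classical.arbitrary (P.M l)})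

/-- The product of the covering degrees of the first `l` bonding maps. -/
noncomputable def degreeProd (l : ℕ) : ℕ := ∏ i ∈ Finset.range l, P.degree i

/-- The Steinitz number `ξ(P)`: the least common multiple of the products of the covering
degrees. -/
noncomputable def steinitz : SteinitzNumber :=
  SteinitzNumber.lcm {d | ∃ l, 0 < l ∧ d = P.degreeProd l}

/-- The subgroup `Γ_l` of `Γ = π₁(M 0, x 0)`: the image of `π₁(M l, x l)`. -/
noncomputable def groupChain (x : P.Solenoid) (l : ℕ) : Subgroup (FundamentalGroup (P.M 0) (x.1 0)) :=
  (FundamentalGroup.mapOfEq ⟨P.qbar l, P.continuous_qbar l⟩ (P.qbar_apply x l)).range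

end Presentation

/-! Part (1) is monodromy: all fibres of a covering of a path-connected space are equinumerous,
degrees multiply under composition, and orbit-stabilizer gives the index (`index_range_mapOfEq`).

For (2) it suffices, by symmetry and `asympEquiv_of_le`, that a homeomorphism `h` of solenoids
forces each m_1⋯m_j to divide A·m'_1⋯m'_k for some k, with A > 0 independent of j
(`exists_degreeProd_dvd`). After deletion of finitely many levels there are path-connected open sets
`D`, `D'` in the bases such that `h` maps the part over `D` into the part over `D'`, closed paths in
`D'` lift to closed paths, and `h⁻¹` maps the part over `D'` into a set in which no path joins
distinct points of a fibre. Call the path components over `D'` plaques; those of level k correspond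
to the m'_1⋯m'_k points over some b in `D'`. Let W_k be the number of level-k plaques met by the
image of the fibre K over some a in `D`.

Whether a plaque meets the image of K is decided at some level l, so W_k·m'_1⋯m'_l = W_l·m'_1⋯m'_k
for k ≥ l (`exists_ncard_plaques_mul`). For fixed j and large k, a level-k plaque determines the
level-j coordinate of the points of K mapped into it (`exists_level_proj_eq`), which splits the W_k
plaques into m_1⋯m_j classes. Transport along a loop that lifts to a path from c to d in M_j
respects the plaques of close points (`exists_level_joinedIn_iff`), so the classes have equal size
(`eventually_ncard_plaques_le`). Hence m_1⋯m_j divides W_k, and A = W_l works, up to the degrees of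
the deleted maps. -/

open Topology Set unitInterval

/-! ### Fibres of covering maps -/

namespace IsCoveringMap

variable {E X : Type*} [TopologicalSpace E] [TopologicalSpace X] {p : E → X}

theorem nat_card_fiber_eq (hp : IsCoveringMap p) [PathConnectedSpace X] (x y : X) :
    Nat.card (p ⁻¹' {x}) = Nat.card (p ⁻¹' {y}) :=
  Nat.card_congr (Equiv.ofBijective _
    (hp.monodromy_bijective (.mk (PathConnectedSpace.somePath x y))))

theorem surjective_of_nonempty (hp : IsCoveringMap p) [PathConnectedSpace X] [Nonempty E] :
    Function.Surjective p := fun y =>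
  have e : E := Classical.arbitrary E
  have z := hp.monodromy (.mk (PathConnectedSpace.somePath (p e) y)) ⟨e, rfl⟩
  ⟨z.1, z.2⟩

/-- The stabilizer of a point under the monodromy action is the image of the fundamental group
of the covering space. -/
theorem monodromy_eq_self_iff (hp : IsCoveringMap p) {e : E} {x : X} (he : p e = x)
    (γ : FundamentalGroup X x) :
    hp.monodromy γ ⟨e, he⟩ = ⟨e, he⟩ ↔
      γ ∈ (FundamentalGroup.mapOfEq ⟨p, hp.continuous⟩ he).range := by
  constructor
  · intro h
    refine ⟨(hp.liftPathQuotient γ ⟨e, he⟩).cast rfl (congrArg Subtype.val h.symm), ?_⟩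
    rw [FundamentalGroup.mapOfEq_apply, Path.Homotopic.Quotient.map_cast,
      IsCoveringMap.map_liftPathQuotient]
    subst he
    simp only [Path.Homotopic.Quotient.cast_cast]
    exact (Path.Homotopic.Quotient.cast_cast ..).trans (Path.Homotopic.Quotient.cast_rfl_rfl γ)
  · rintro ⟨γ, rfl⟩
    refine hp.monodromy_eq_of_map_eq γ ?_
    rw [FundamentalGroup.mapOfEq_apply]
    aesop

/-- The index of the image of the fundamental group of a path-connected covering space is the
number of sheets. -/
theorem index_range_mapOfEq (hp : IsCoveringMap p) [PathConnectedSpace E] {e : E} {x : X}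
    (he : p e = x) :
    (FundamentalGroup.mapOfEq ⟨p, hp.continuous⟩ he).range.index = Nat.card (p ⁻¹' {x}) := by
  let _ := hp.fundamentalGroupMulAction x
  have htrans : MulAction.IsPretransitive (FundamentalGroup X x) (p ⁻¹' {x}) := by
    refine ⟨fun e₁ e₂ => ?_⟩
    let Γ : Path.Homotopic.Quotient e₁.1 e₂.1 := .mk (PathConnectedSpace.somePath e₁.1 e₂.1)
    refine ⟨(Γ.map ⟨p, hp.continuous⟩).cast e₁.2.symm e₂.2.symm, ?_⟩
    refine hp.monodromy_eq_of_map_eq Γ ?_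
    aesop
  rw [← MulAction.index_stabilizer_of_transitive (FundamentalGroup X x) (⟨e, he⟩ : p ⁻¹' {x})]
  congr 1
  ext γ
  exact (hp.monodromy_eq_self_iff he γ).symm

end IsCoveringMap

/-! ### The spaces and maps of a presentation -/

namespace Presentation

variable {n : ℕ} (P : Presentation.{u} n)

instance (l : ℕ) : LocallyPathConnectedSpace (P.M l) := by
  obtain ⟨_⟩ := P.chartedSpace l
  exact ChartedSpace.locallyPathConnectedSpace (EuclideanSpace ℝ (Fin n)) (P.M l)

instance (l : ℕ) : PathConnectedSpace (P.M l) := .of_locallyPathConnectedSpace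

theorem q_surjective (l : ℕ) : Function.Surjective (P.q l) :=
  (P.isCoveringMap_q l).surjective_of_nonempty

theorem isCoveringMap_qbar (l : ℕ) : IsCoveringMap (P.qbar l) := by
  -- Covering maps need not compose, but local homeomorphisms do, and between compact Hausdorff
  -- spaces the two notions agree.
  refine isLocalHomeomorph_iff_isCoveringMap.mp ?_
  induction l with
  | zero => exact (Homeomorph.refl _).isLocalHomeomorph
  | succ l ih => exact ih.comp (P.isCoveringMap_q l).isLocalHomeomorph

theorem nat_card_fiber_q (l : ℕ) (y : P.M l) : Nat.card (P.q l ⁻¹' {y}) = P.degree l :=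
  (P.isCoveringMap_q l).nat_card_fiber_eq _ _

theorem degree_pos (l : ℕ) : 0 < P.degree l := by
  obtain ⟨z, hz⟩ := P.q_surjective l (Classical.arbitrary (P.M l))
  have := (P.finite_fiber_q l (Classical.arbitrary (P.M l))).to_subtype
  have : Nonempty (P.q l ⁻¹' {Classical.arbitrary (P.M l)}) := ⟨z, hz⟩
  exact Nat.card_pos

theorem degreeProd_succ (l : ℕ) : P.degreeProd (l + 1) = P.degreeProd l * P.degree l :=
  Finset.prod_range_succ _ _

/-- The preimage of a finite set under a bonding map. -/
theorem finite_preimage_q (l : ℕ) {s : Set (P.M l)} (hs : s.Finite) : (P.q l ⁻¹' s).Finite :=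
  hs.preimage' fun y _ => P.finite_fiber_q l y

theorem ncard_preimage_q (l : ℕ) {s : Set (P.M l)} (hs : s.Finite) :
    (P.q l ⁻¹' s).ncard = s.ncard * P.degree l := by
  classical
  induction s, hs using Set.Finite.induction_on with
  | empty => simp
  | @insert y s hy hs ih =>
    rw [insert_eq, preimage_union, ncard_union_eq _ (P.finite_fiber_q l y)
      (P.finite_preimage_q l hs), ih, ← insert_eq, ncard_insert_of_notMem hy hs,
      ← Nat.card_coe_set_eq, P.nat_card_fiber_q]
    · ring
    · exact Disjoint.preimage _ (by simpa using hy)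

theorem finite_fiber_qbar (l : ℕ) (y : P.M 0) : (P.qbar l ⁻¹' {y}).Finite := by
  induction l with
  | zero => exact finite_singleton y
  | succ l ih => exact P.finite_preimage_q l ih

theorem ncard_fiber_qbar (l : ℕ) (y : P.M 0) : (P.qbar l ⁻¹' {y}).ncard = P.degreeProd l := by
  induction l with
  | zero => simp [qbar, degreeProd]
  | succ l ih =>
    rw [degreeProd_succ, ← ih]
    exact P.ncard_preimage_q l (P.finite_fiber_qbar l y)

theorem index_groupChain (x : P.Solenoid) (l : ℕ) : (P.groupChain x l).index = P.degreeProd l := by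
  rw [← P.ncard_fiber_qbar l (x.1 0), ← Nat.card_coe_set_eq]
  exact (P.isCoveringMap_qbar l).index_range_mapOfEq (P.qbar_apply x l)

end Presentation

/-! ### Path lifting and simply connected neighbourhoods -/

namespace IsCoveringMap

variable {E X : Type*} [TopologicalSpace E] [TopologicalSpace X] {p : E → X}

/-- Over a simply connected set, a path joining two points of a fibre is closed. -/
theorem eq_of_joinedIn (hp : IsCoveringMap p) {D : Set X} [SimplyConnectedSpace D] {z w : E}
    (h : JoinedIn (p ⁻¹' D) z w) (hzw : p z = p w) : z = w := by
  obtain ⟨Γ, hΓ⟩ := h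
  let γ : Path (⟨p z, Γ.source ▸ hΓ 0⟩ : D) ⟨p z, Γ.source ▸ hΓ 0⟩ :=
    { toFun t := ⟨p (Γ t), hΓ t⟩
      continuous_toFun := (hp.continuous.comp Γ.continuous).subtype_mk _
      source' := by simp
      target' := by simp [hzw] }
  -- The projected loop is null-homotopic in `D`, so its lift `Γ` ends where the constant lift at
  -- `z` does.
  have H := ContinuousMap.HomotopicRel.comp_continuousMap
    (SimplyConnectedSpace.paths_homotopic γ (Path.refl _)) ⟨Subtype.val, continuous_subtype_val⟩
  have h₁ := hp.liftPath_apply_one_eq_of_homotopicRel H z (by simp) (by simp)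
  have h₂ : (Γ : C(I, E)) = hp.liftPath _ z _ :=
    (hp.eq_liftPath_iff' (γ := (ContinuousMap.comp ⟨Subtype.val, continuous_subtype_val⟩
      γ.toContinuousMap)) (by simp)).mpr ⟨rfl, Γ.source⟩
  have h₃ : ContinuousMap.const I z = hp.liftPath _ z _ :=
    (hp.eq_liftPath_iff' (γ := (ContinuousMap.comp ⟨Subtype.val, continuous_subtype_val⟩
      (Path.refl (⟨p z, Γ.source ▸ hΓ 0⟩ : D)).toContinuousMap)) (by simp)).mpr ⟨rfl, rfl⟩
  have h₄ : Γ 1 = z := ((DFunLike.congr_fun h₂ 1).trans h₁).trans (DFunLike.congr_fun h₃.symm 1)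
  exact h₄.symm.trans Γ.target

/-- Paths in the base lift to paths in the covering space. -/
theorem exists_joinedIn_of_joinedIn (hp : IsCoveringMap p) {D : Set X} {z : E} {y : X}
    (h : JoinedIn D (p z) y) : ∃ w, p w = y ∧ JoinedIn (p ⁻¹' D) z w := by
  obtain ⟨γ, hγ⟩ := h
  have hl := hp.liftPath_lifts γ z γ.source
  refine ⟨hp.liftPath γ z γ.source 1, (congr_fun hl 1).trans γ.target,
    ⟨⟨hp.liftPath γ z γ.source, hp.liftPath_zero _ _ _, rfl⟩, fun t => ?_⟩⟩
  change p (hp.liftPath γ z γ.source t) ∈ D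
  rw [show p (hp.liftPath γ z γ.source t) = γ t from congr_fun hl t]
  exact hγ t

end IsCoveringMap

/-- Every point of a locally Euclidean space has a simply connected open neighbourhood. -/
theorem exists_isOpen_simplyConnectedSpace (F : Type*) [NormedAddCommGroup F] [NormedSpace ℝ F]
    {X : Type*} [TopologicalSpace X] [ChartedSpace F X] (x : X) :
    ∃ D : Set X, IsOpen D ∧ x ∈ D ∧ SimplyConnectedSpace D := by
  let e := chartAt F x
  have hx : x ∈ e.source := mem_chart_source F x
  obtain ⟨r, hr, hB⟩ := Metric.isOpen_iff.mp e.open_target _ (e.map_source hx)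
  let f := e.symm.restrOpen (Metric.ball (e x) r) Metric.isOpen_ball
  have hs : f.source = Metric.ball (e x) r := inter_eq_right.mpr hB
  have : ContractibleSpace f.source := by
    rw [hs]
    exact (convex_ball _ _).contractibleSpace ⟨_, Metric.mem_ball_self hr⟩
  have : ContractibleSpace f.target := f.toHomeomorphSourceTarget.symm.contractibleSpace
  refine ⟨f.target, f.open_target, ?_, inferInstance⟩
  have hxs : e x ∈ f.source := hs ▸ Metric.mem_ball_self hr
  have := f.map_source hxs
  rwa [show f (e x) = x from e.left_inv hx] at this

namespace Presentation

variable {n : ℕ} (P : Presentation.{u} n)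

/-! ### The topology of the solenoid -/

namespace Solenoid

theorem continuous_proj (l : ℕ) : Continuous fun x : P.Solenoid => x.1 l :=
  (continuous_apply l).comp continuous_subtype_val

instance : T2Space P.Solenoid :=
  inferInstanceAs (T2Space {x : ∀ l, P.M l // ∀ l, P.q l (x (l + 1)) = x l})

instance : CompactSpace P.Solenoid := by
  refine isCompact_iff_compactSpace.mp (IsClosed.isCompact ?_)
  have : {x : ∀ l, P.M l | ∀ l, P.q l (x (l + 1)) = x l} =
      ⋂ l, {x | P.q l (x (l + 1)) = x l} := by ext; simp
  change IsClosed {x : ∀ l, P.M l | ∀ l, P.q l (x (l + 1)) = x l}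
  rw [this]
  exact isClosed_iInter fun l => isClosed_eq
    ((P.isCoveringMap_q l).continuous.comp (continuous_apply _)) (continuous_apply _)

variable {P}

theorem proj_eq_of_le {x y : P.Solenoid} {k l : ℕ} (hkl : k ≤ l) (h : x.1 l = y.1 l) :
    x.1 k = y.1 k := by
  induction l, hkl using Nat.le_induction with
  | base => exact h
  | succ l _ ih => exact ih (by rw [← x.2 l, ← y.2 l, h])

theorem ext {x y : P.Solenoid} (h : ∀ l, x.1 l = y.1 l) : x = y := Subtype.ext (funext h)

/-- A neighbourhood of a point of the solenoid at a finite level contains the neighbourhoods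
coming from all higher levels. -/
theorem exists_isOpen_proj_of_le {x : P.Solenoid} {k l : ℕ} (hkl : k ≤ l) {O : Set (P.M k)}
    (hO : IsOpen O) (hx : x.1 k ∈ O) :
    ∃ O' : Set (P.M l), IsOpen O' ∧ x.1 l ∈ O' ∧ ∀ y : P.Solenoid, y.1 l ∈ O' → y.1 k ∈ O := by
  induction l, hkl using Nat.le_induction with
  | base => exact ⟨O, hO, hx, fun _ h => h⟩
  | succ l _ ih =>
    obtain ⟨O', hO', hx', h⟩ := ih
    refine ⟨P.q l ⁻¹' O', hO'.preimage (P.isCoveringMap_q l).continuous, ?_, fun y hy => h y ?_⟩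
    · rwa [mem_preimage, x.2 l]
    · rwa [mem_preimage, y.2 l] at hy

/-- The neighbourhoods coming from the finite levels form a basis. -/
theorem exists_isOpen_proj {x : P.Solenoid} {U : Set P.Solenoid} (hU : IsOpen U) (hx : x ∈ U) :
    ∃ (l : ℕ) (O : Set (P.M l)), IsOpen O ∧ x.1 l ∈ O ∧ ∀ y : P.Solenoid, y.1 l ∈ O → y ∈ U := by
  obtain ⟨V, hV, rfl⟩ := isOpen_induced_iff.mp hU
  obtain ⟨s, u, hu, hs⟩ := isOpen_pi_iff.mp hV _ hx
  have key : ∀ i ∈ s, ∃ O' : Set (P.M (s.sup id)), IsOpen O' ∧ x.1 (s.sup id) ∈ O' ∧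
      ∀ y : P.Solenoid, y.1 (s.sup id) ∈ O' → y.1 i ∈ u i := fun i hi =>
    exists_isOpen_proj_of_le (Finset.le_sup (f := id) hi) (hu i hi).1 (hu i hi).2
  choose! O hO hxO h using key
  refine ⟨s.sup id, ⋂ i ∈ s, O i, isOpen_biInter_finset hO, mem_iInter₂.mpr hxO, fun y hy => ?_⟩
  exact hs fun i hi => h i hi y (mem_iInter₂.mp hy i hi)

variable (P) in
/-- The fibre of the solenoid over a point of the base manifold. -/
def fiber (a : P.M 0) : Set P.Solenoid := {x | x.1 0 = a}

theorem isCompact_fiber (a : P.M 0) : IsCompact (fiber P a) :=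
  (isClosed_eq (continuous_proj P 0) continuous_const).isCompact

/-- On a fibre, points close to `x` have the same projection as `x` to a given level. -/
theorem eventually_proj_eq (l : ℕ) (x : P.Solenoid) :
    ∀ᶠ y in 𝓝[fiber P (x.1 0)] x, y.1 l = x.1 l := by
  obtain ⟨N, hN, hxN, hinj⟩ :=
    (P.isCoveringMap_qbar l).isLocalHomeomorph.isLocallyInjective (x.1 l)
  have : ∀ᶠ y in 𝓝[fiber P (x.1 0)] x, y.1 l ∈ N :=
    ((continuous_proj P l).continuousAt.eventually_mem (hN.mem_nhds hxN)).filter_mono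
      nhdsWithin_le_nhds
  filter_upwards [this, self_mem_nhdsWithin] with y hy hy0
  refine hinj hy hxN ?_
  rw [P.qbar_apply, P.qbar_apply]
  exact hy0

/-- On a fibre, the sets of points with a given projection to some level form a basis. -/
theorem exists_forall_proj_eq {x : P.Solenoid} {U : Set P.Solenoid}
    (hU : U ∈ 𝓝[fiber P (x.1 0)] x) :
    ∃ l, ∀ y ∈ fiber P (x.1 0), y.1 l = x.1 l → y ∈ U := by
  obtain ⟨V, hV, hx, hVU⟩ := mem_nhdsWithin.mp hU
  obtain ⟨l, O, -, hxO, h⟩ := exists_isOpen_proj hV hx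
  exact ⟨l, fun y hy hyx => hVU ⟨h y (hyx ▸ hxO), hy⟩⟩

/-- Compactness of a fibre: a property of pairs of points of a fibre, valid for all pairs of
sufficiently close points near every point, is valid for all sufficiently close points. -/
theorem exists_uniform_level {a : P.M 0} {R : P.Solenoid → P.Solenoid → Prop}
    (h : ∀ x ∈ fiber P a, ∃ k, ∀ y ∈ fiber P a, ∀ z ∈ fiber P a,
      y.1 k = x.1 k → z.1 k = x.1 k → R y z) :
    ∃ k, ∀ y ∈ fiber P a, ∀ z ∈ fiber P a, y.1 k = z.1 k → R y z := by
  let T (k : ℕ) : Set P.Solenoid := {x | ∀ y ∈ fiber P a, ∀ z ∈ fiber P a,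
      y.1 k = x.1 k → z.1 k = x.1 k → R y z}
  have hT : Monotone T := fun k l hkl x hx y hy z hz hyx hzx =>
    hx y hy z hz (proj_eq_of_le hkl hyx) (proj_eq_of_le hkl hzx)
  obtain ⟨k, hk⟩ := (isCompact_fiber a).elim_nhdsWithin_subcover' (fun x hx => T (h x hx).choose) (by
    rintro x rfl
    filter_upwards [eventually_proj_eq (h x rfl).choose x] with w hw y hy z hz hyw hzw
    exact (h x rfl).choose_spec y hy z hz (hyw.trans hw) (hzw.trans hw))
  refine ⟨k.sup fun x => (h x.1 x.2).choose, fun y hy z hz hyz => ?_⟩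
  obtain ⟨x, hx, hyx⟩ := mem_iUnion₂.mp (hk hy)
  exact hT (Finset.le_sup (f := fun x => (h x.1 x.2).choose) hx) hyx y hy z hz rfl hyz.symm

end Solenoid

end Presentation

namespace Presentation

variable {n : ℕ} (P : Presentation.{u} n)

/-! ### Deleting the first manifold of a presentation -/

/-- The presentation without its first manifold. -/
def shift : Presentation.{u} n where
  M l := P.M (l + 1)
  topologicalSpace l := P.topologicalSpace (l + 1)
  t2Space l := P.t2Space (l + 1)
  compactSpace l := P.compactSpace (l + 1)
  connectedSpace l := P.connectedSpace (l + 1)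
  chartedSpace l := P.chartedSpace (l + 1)
  q l := P.q (l + 1)
  isCoveringMap_q l := P.isCoveringMap_q (l + 1)
  finite_fiber_q l := P.finite_fiber_q (l + 1)

theorem degreeProd_succ' (l : ℕ) : P.degreeProd (l + 1) = P.degree 0 * P.shift.degreeProd l :=
  (Finset.prod_range_succ' _ _).trans (mul_comm _ _)

/-- Extend a point of the solenoid of `P.shift` by its image in the first manifold of `P`. -/
def unshift (y : P.shift.Solenoid) : P.Solenoid where
  val
    | 0 => P.q 0 (y.1 0)
    | l + 1 => y.1 l
  property
    | 0 => rfl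
    | l + 1 => y.2 l

/-- The solenoid does not change when the first manifold is deleted. -/
def shiftHomeomorph : P.shift.Solenoid ≃ₜ P.Solenoid where
  toFun := P.unshift
  invFun x := ⟨fun l => x.1 (l + 1), fun l => x.2 (l + 1)⟩
  left_inv _ := rfl
  right_inv x := Solenoid.ext fun
    | 0 => x.2 0
    | _ + 1 => rfl
  continuous_toFun := by
    refine Continuous.subtype_mk (continuous_pi fun l => ?_) _
    cases l with
    | zero => exact (P.isCoveringMap_q 0).continuous.comp (Solenoid.continuous_proj P.shift 0)
    | succ l => exact Solenoid.continuous_proj P.shift l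
  continuous_invFun :=
    Continuous.subtype_mk (continuous_pi fun l => Solenoid.continuous_proj P (l + 1)) _

namespace Solenoid

/-- At level zero, sections of the bonding maps give the coordinates recursively; a higher level is
lowered by `shift`, so the induction ranges over all presentations. -/
theorem exists_proj_eq : ∀ {n : ℕ} (P : Presentation.{u} n) (l : ℕ) (z : P.M l),
    ∃ x : P.Solenoid, x.1 l = z
  | _, P, 0, z => by
    choose s hs using P.q_surjective
    exact ⟨⟨fun l => Nat.rec z (fun l y => s l y) l, fun l => hs l _⟩, rfl⟩
  | _, P, l + 1, z => by
    obtain ⟨y, hy⟩ := exists_proj_eq P.shift l z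
    exact ⟨P.shiftHomeomorph y, hy⟩

/-! ### Lifting paths to the solenoid -/

variable {P}

/-- The homotopy lifting property of the projection to the base manifold. -/
theorem exists_lift_homotopy {A : Type*} [TopologicalSpace A] (H : C(I × A, P.M 0))
    (f : C(A, P.Solenoid)) (hf : ∀ a, H (0, a) = (f a).1 0) :
    ∃ F : C(I × A, P.Solenoid), (∀ t, (F t).1 0 = H t) ∧ ∀ a, F (0, a) = f a := by
  let g (l : ℕ) : C(A, P.M l) := ⟨fun a => (f a).1 l, (continuous_proj P l).comp f.continuous⟩
  have h0 (l : ℕ) (a : A) : H (0, a) = P.qbar l (g l a) := (hf a).trans (P.qbar_apply (f a) l).symm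
  let F (l : ℕ) : C(I × A, P.M l) := (P.isCoveringMap_qbar l).liftHomotopy H (g l) (h0 l)
  have hF (l : ℕ) : P.qbar l ∘ F l = H := (P.isCoveringMap_qbar l).liftHomotopy_lifts H (g l) (h0 l)
  have hF0 (l : ℕ) (a : A) : F l (0, a) = (f a).1 l :=
    (P.isCoveringMap_qbar l).liftHomotopy_zero H (g l) (h0 l) a
  -- Both sides lift `H` through `qbar l` with the same initial values, so uniqueness makes the
  -- levelwise lifts compatible.
  have hq (l : ℕ) : P.q l ∘ F (l + 1) = F l := by
    refine ((P.isCoveringMap_qbar l).eq_liftHomotopy_iff (h0 l) _).mpr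
      ⟨fun a => ?_, hF (l + 1), fun a => ?_⟩
    · exact (P.isCoveringMap_q l).continuous.comp ((F (l + 1)).continuous.comp (by fun_prop))
    · exact (congrArg (P.q l) (hF0 (l + 1) a)).trans ((f a).2 l)
  exact ⟨⟨fun t => ⟨fun l => F l t, fun l => congr_fun (hq l) t⟩,
    Continuous.subtype_mk (continuous_pi fun l => (F l).continuous) _⟩,
    congr_fun (hF 0), fun a => ext fun l => hF0 l a⟩

/-- Two paths in the solenoid over the same path in the base manifold which agree somewhere at
some level agree everywhere at this level. -/
theorem proj_eq_of_lifts {T : Type*} [TopologicalSpace T] [PreconnectedSpace T]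
    {F G : T → P.Solenoid} (hF : Continuous F) (hG : Continuous G)
    (h : ∀ t, (F t).1 0 = (G t).1 0) {l : ℕ} {s : T} (hs : (F s).1 l = (G s).1 l) (t : T) :
    (F t).1 l = (G t).1 l := by
  refine congr_fun ((P.isCoveringMap_qbar l).eq_of_comp_eq ((continuous_proj P l).comp hF)
    ((continuous_proj P l).comp hG) (funext fun t => ?_) s hs) t
  simpa only [Function.comp_apply, qbar_apply] using h t

variable (P) in
/-- The part of the solenoid over a set in the base manifold. -/
def above (D : Set (P.M 0)) : Set P.Solenoid := {x | x.1 0 ∈ D}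

theorem isOpen_above {D : Set (P.M 0)} (hD : IsOpen D) : IsOpen (above P D) :=
  hD.preimage (continuous_proj P 0)

theorem joinedIn_proj {D : Set (P.M 0)} {x y : P.Solenoid} (h : JoinedIn (above P D) x y) (l : ℕ) :
    JoinedIn (P.qbar l ⁻¹' D) (x.1 l) (y.1 l) := by
  refine (h.map (continuous_proj P l)).mono ?_
  rintro _ ⟨z, hz, rfl⟩
  exact mem_preimage.mpr ((P.qbar_apply z l).symm ▸ hz)

theorem joinedIn_proj_of_le {D : Set (P.M 0)} {x y : P.Solenoid} {k l : ℕ} (hkl : k ≤ l)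
    (h : JoinedIn (P.qbar l ⁻¹' D) (x.1 l) (y.1 l)) :
    JoinedIn (P.qbar k ⁻¹' D) (x.1 k) (y.1 k) := by
  induction l, hkl using Nat.le_induction with
  | base => exact h
  | succ l _ ih =>
    have := h.map (P.isCoveringMap_q l).continuous
    rw [x.2 l, y.2 l] at this
    refine ih (this.mono ?_)
    rintro _ ⟨z, hz, rfl⟩
    exact hz

/-- Paths in the base manifold lift to the solenoid. -/
theorem exists_joinedIn {D : Set (P.M 0)} {x : P.Solenoid} {b : P.M 0} (h : JoinedIn D (x.1 0) b) :
    ∃ y : P.Solenoid, y.1 0 = b ∧ JoinedIn (above P D) x y := by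
  obtain ⟨γ, hγ⟩ := h
  obtain ⟨F, hF, hF0⟩ := exists_lift_homotopy (P := P) (A := Unit)
    ⟨fun t => γ t.1, by fun_prop⟩ (.const _ x) fun _ => γ.source
  refine ⟨F (1, ()), (hF _).trans γ.target,
    ⟨⟨⟨fun t => F (t, ()), by fun_prop⟩, hF0 _, rfl⟩, fun t => ?_⟩⟩
  change (F (t, ())).1 0 ∈ D
  rw [hF]
  exact hγ t

end Solenoid

/-! ### Sets without holonomy -/

/-- A set in the base manifold over which all closed paths lift to closed paths in all manifolds
of the presentation. -/
def IsHolonomyFree (D : Set (P.M 0)) : Prop :=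
  ∀ (l : ℕ) (z w : P.M l), JoinedIn (P.qbar l ⁻¹' D) z w → P.qbar l z = P.qbar l w → z = w

variable {P}

theorem IsHolonomyFree.mono {D E : Set (P.M 0)} (hD : P.IsHolonomyFree D) (hED : E ⊆ D) :
    P.IsHolonomyFree E :=
  fun l z w h => hD l z w (h.mono (preimage_mono hED))

/-- Two points over a path-connected subset `B` of a set `D` without holonomy, joined over `D`,
are joined over `B`. -/
theorem IsHolonomyFree.joinedIn_of_subset {D B : Set (P.M 0)} (hD : P.IsHolonomyFree D)
    (hBD : B ⊆ D) (hB : IsPathConnected B) {l : ℕ} {z w : P.M l} (hz : P.qbar l z ∈ B)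
    (hw : P.qbar l w ∈ B) (h : JoinedIn (P.qbar l ⁻¹' D) z w) : JoinedIn (P.qbar l ⁻¹' B) z w := by
  obtain ⟨w', hw', h'⟩ := (P.isCoveringMap_qbar l).exists_joinedIn_of_joinedIn
    (hB.joinedIn _ hz _ hw)
  have : w' = w := hD l _ _ ((h'.mono (preimage_mono hBD)).symm.trans h) hw'
  exact this ▸ h'

variable (P) in
-- A simply connected neighbourhood has no holonomy. This passes to subsets, so the final set need
-- only be path connected.
theorem exists_isHolonomyFree {O : Set (P.M 0)} (hO : IsOpen O) {y : P.M 0} (hy : y ∈ O) :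
    ∃ D ⊆ O, IsOpen D ∧ y ∈ D ∧ IsPathConnected D ∧ P.IsHolonomyFree D := by
  obtain ⟨_⟩ := P.chartedSpace 0
  obtain ⟨D, hD, hyD, hsc⟩ := exists_isOpen_simplyConnectedSpace (EuclideanSpace ℝ (Fin n)) y
  obtain ⟨B, ⟨hBo, hyB, hBc⟩, hBO⟩ :=
    (isOpen_isPathConnected_basis y).mem_iff.mp ((hO.inter hD).mem_nhds ⟨hy, hyD⟩)
  refine ⟨B, hBO.trans inter_subset_left, hBo, hyB, hBc, ?_⟩
  have : P.IsHolonomyFree D := fun l z w => (P.isCoveringMap_qbar l).eq_of_joinedIn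
  exact this.mono (hBO.trans inter_subset_right)

/-- A continuous family of points of `M l` over an open set is locally constant up to paths over
this set. -/
theorem eventually_joinedIn {D : Set (P.M 0)} (hD : IsOpen D) {l : ℕ} {z : P.M l}
    (hz : P.qbar l z ∈ D) : ∀ᶠ w in 𝓝 z, JoinedIn (P.qbar l ⁻¹' D) z w :=
  pathComponentIn_mem_nhds ((hD.preimage (P.continuous_qbar l)).mem_nhds hz)

end Presentation

/-! ### Transport of plaques along paths -/

namespace Presentation

variable {n : ℕ} {P : Presentation.{u} n}

/-- Near a point, being joined over a set without holonomy does not depend on this set. -/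
theorem IsHolonomyFree.exists_joinedIn_iff {D E : Set (P.M 0)} (hD : IsOpen D)
    (hDf : P.IsHolonomyFree D) (hE : IsOpen E) (hEf : P.IsHolonomyFree E)
    {A : Type*} [TopologicalSpace A] {f : A → P.Solenoid} (hf : Continuous f) {v : A}
    (hvD : (f v).1 0 ∈ D) (hvE : (f v).1 0 ∈ E) :
    ∀ᶠ w in 𝓝 v ×ˢ 𝓝 v, ∀ j, JoinedIn (P.qbar j ⁻¹' D) ((f w.1).1 j) ((f w.2).1 j) ↔
      JoinedIn (P.qbar j ⁻¹' E) ((f w.1).1 j) ((f w.2).1 j) := by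
  obtain ⟨B, ⟨hBo, hvB, hBc⟩, hB⟩ :=
    (isOpen_isPathConnected_basis ((f v).1 0)).mem_iff.mp ((hD.inter hE).mem_nhds ⟨hvD, hvE⟩)
  have hN : ∀ᶠ w in 𝓝 v, (f w).1 0 ∈ B :=
    ((Solenoid.continuous_proj P 0).comp hf).continuousAt.eventually_mem (hBo.mem_nhds hvB)
  have hBD : B ⊆ D := hB.trans inter_subset_left
  have hBE : B ⊆ E := hB.trans inter_subset_right
  filter_upwards [hN.prod_mk hN] with w hw j
  have h₁ : P.qbar j ((f w.1).1 j) ∈ B := (P.qbar_apply _ j).symm ▸ hw.1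
  have h₂ : P.qbar j ((f w.2).1 j) ∈ B := (P.qbar_apply _ j).symm ▸ hw.2
  exact ⟨fun h => (hDf.joinedIn_of_subset hBD hBc h₁ h₂ h).mono (preimage_mono hBE),
    fun h => (hEf.joinedIn_of_subset hBE hBc h₁ h₂ h).mono (preimage_mono hBD)⟩

/-- In a continuous family of paths in the solenoid, the starting points of two paths close to
a given path are joined at some level over a small set if and only if the end points are. -/
theorem IsHolonomyFree.joinedIn_iff_of_homotopy {D E : Set (P.M 0)} (hD : IsOpen D)
    (hDf : P.IsHolonomyFree D) (hE : IsOpen E) (hEf : P.IsHolonomyFree E)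
    {A : Type*} [TopologicalSpace A] (F : C(I × A, P.Solenoid)) {v : A}
    (hvD : (F (0, v)).1 0 ∈ D) (hvE : (F (1, v)).1 0 ∈ E) :
    ∀ᶠ w in 𝓝 v ×ˢ 𝓝 v, ∀ j,
      JoinedIn (P.qbar j ⁻¹' D) ((F (0, w.1)).1 j) ((F (0, w.2)).1 j) ↔
      JoinedIn (P.qbar j ⁻¹' E) ((F (1, w.1)).1 j) ((F (1, w.2)).1 j) := by
  have hcont (t : I) : Continuous fun w => F (t, w) := by fun_prop
  -- Quantifying over all times `s`, `t` and all small sets makes the relation symmetric and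
  -- transitive in the times. Since it holds for nearby times, connectedness of `I` gives it for 0
  -- and 1.
  have key := isPreconnected_univ.induction₂ (α := I) (fun s t => ∀ D E : Set (P.M 0),
    IsOpen D → P.IsHolonomyFree D → IsOpen E → P.IsHolonomyFree E → (F (s, v)).1 0 ∈ D →
    (F (t, v)).1 0 ∈ E → ∀ᶠ w in 𝓝 v ×ˢ 𝓝 v, ∀ j,
      JoinedIn (P.qbar j ⁻¹' D) ((F (s, w.1)).1 j) ((F (s, w.2)).1 j) ↔
      JoinedIn (P.qbar j ⁻¹' E) ((F (t, w.1)).1 j) ((F (t, w.2)).1 j)) ?_ ?_ ?_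
    (mem_univ 0) (mem_univ 1)
  · exact key D E hD hDf hE hEf hvD hvE
  · intro s _
    rw [nhdsWithin_univ]
    obtain ⟨B, -, hB, hvB, -, hBf⟩ :=
      P.exists_isHolonomyFree isOpen_univ (mem_univ ((F (s, v)).1 0))
    have hev : ∀ᶠ x in 𝓝 s ×ˢ 𝓝 v, F x ∈ Solenoid.above P B := by
      rw [← nhds_prod_eq]
      exact F.continuous.continuousAt.eventually_mem ((Solenoid.isOpen_above hB).mem_nhds hvB)
    obtain ⟨T, hT, N, hN, hTN⟩ := Filter.eventually_prod_iff.mp hev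
    have : LocallyPathConnectedSpace I := (convex_Icc (0 : ℝ) 1).locallyPathConnectedSpace
    obtain ⟨T', ⟨hT', hTc⟩, hTT⟩ := (path_connected_basis s).mem_iff.mp hT
    filter_upwards [hT'] with t ht D E hD hDf hE hEf hvD hvE
    filter_upwards [hDf.exists_joinedIn_iff hD hB hBf (hcont s) hvD hvB,
      hBf.exists_joinedIn_iff hB hE hEf (hcont t) (hTN (hTT ht) hN.self_of_nhds) hvE,
      hN.prod_mk hN] with w h₁ h₂ h₃ j
    -- Between the close times `s` and `t`, each point moves inside one plaque over `B`.
    have hj {w : A} (hw : N w) : JoinedIn (P.qbar j ⁻¹' B) ((F (s, w)).1 j) ((F (t, w)).1 j) := by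
      refine Solenoid.joinedIn_proj (((hTc.joinedIn s (mem_of_mem_nhds hT') t ht).map
        (f := fun r => F (r, w)) (by fun_prop)).mono ?_) j
      rintro _ ⟨r, hr, rfl⟩
      exact hTN (hTT hr) hw
    refine (h₁ j).trans (Iff.trans ?_ (h₂ j))
    exact ⟨fun h => (hj h₃.1).symm.trans (h.trans (hj h₃.2)),
      fun h => (hj h₃.1).trans (h.trans (hj h₃.2).symm)⟩
  · intro r s t _ _ _ hrs hst D E hD hDf hE hEf hvD hvE
    obtain ⟨B, -, hB, hvB, -, hBf⟩ :=
      P.exists_isHolonomyFree isOpen_univ (mem_univ ((F (s, v)).1 0))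
    filter_upwards [hrs D B hD hDf hB hBf hvD hvB, hst B E hB hBf hE hEf hvB hvE] with w h₁ h₂ j
    exact (h₁ j).trans (h₂ j)
  · intro s t _ _ hst D E hD hDf hE hEf hvD hvE
    filter_upwards [hst E D hE hEf hD hDf hvE hvD] with w h j
    exact (h j).symm

/-! ### Plaques under a homeomorphism of solenoids -/

namespace Solenoid

variable {n' : ℕ} {P' : Presentation.{v} n'} (h : P.Solenoid ≃ₜ P'.Solenoid)
  {a : P.M 0} {D' : Set (P'.M 0)}

/-- Transport along paths in the source respects the plaques in the target of pairs of
sufficiently close points. -/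
theorem exists_level_joinedIn_iff (hD' : IsOpen D') (hDf : P'.IsHolonomyFree D')
    (haD : ∀ x ∈ fiber P a, h x ∈ above P' D') (L : C(I × fiber P a, P.Solenoid))
    (hL0 : ∀ v, L (0, v) = v) (hL1 : ∀ v, L (1, v) ∈ fiber P a) :
    ∃ k, ∀ y z : fiber P a, y.1.1 k = z.1.1 k → ∀ j,
      (JoinedIn (P'.qbar j ⁻¹' D') ((h y).1 j) ((h z).1 j) ↔
        JoinedIn (P'.qbar j ⁻¹' D') ((h (L (1, y))).1 j) ((h (L (1, z))).1 j)) := by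
  have key := exists_uniform_level (P := P) (a := a) (R := fun y z => ∀ (hy : y ∈ fiber P a)
    (hz : z ∈ fiber P a) (j : ℕ), (JoinedIn (P'.qbar j ⁻¹' D') ((h y).1 j) ((h z).1 j) ↔
      JoinedIn (P'.qbar j ⁻¹' D') ((h (L (1, ⟨y, hy⟩))).1 j) ((h (L (1, ⟨z, hz⟩))).1 j))) ?_
  · obtain ⟨k, hk⟩ := key
    exact ⟨k, fun y z hyz => hk y.1 y.2 z.1 z.2 hyz y.2 z.2⟩
  · rintro x rfl
    have := hDf.joinedIn_iff_of_homotopy hD' hD' hDf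
      (ContinuousMap.comp ⟨h, h.continuous⟩ L) (v := ⟨x, rfl⟩)
      (by simpa [hL0] using show (h x).1 0 ∈ D' from haD x rfl) (haD _ (hL1 _))
    obtain ⟨N, hN, hNN⟩ := Filter.eventually_prod_self_iff'.mp this
    rw [nhds_subtype_eq_comap_nhdsWithin] at hN
    obtain ⟨U, hU, hUN⟩ := hN
    obtain ⟨k, hk⟩ := exists_forall_proj_eq hU
    refine ⟨k, fun y hy z hz hyx hzx hy' hz' j => ?_⟩
    simpa [hL0] using hNN ⟨y, hy⟩ (hUN (hk y hy hyx)) ⟨z, hz⟩ (hUN (hk z hz hzx)) j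

variable {h}

/-- Points of a fibre whose images are in the same plaque of the target coincide. -/
theorem eq_of_forall_joinedIn {U : Set P.Solenoid}
    (hU : ∀ x y : P.Solenoid, JoinedIn U x y → x.1 0 = y.1 0 → x = y)
    (hDc : IsPathConnected D') (hDf : P'.IsHolonomyFree D') (hDU : ∀ x, h x ∈ above P' D' → x ∈ U)
    (haD : ∀ x ∈ fiber P a, h x ∈ above P' D') {x y : P.Solenoid} (hx : x ∈ fiber P a)
    (hy : y ∈ fiber P a) (hxy : ∀ j, JoinedIn (P'.qbar j ⁻¹' D') ((h x).1 j) ((h y).1 j)) :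
    x = y := by
  obtain ⟨z, hz, hxz⟩ := exists_joinedIn (hDc.joinedIn _ (haD x hx) _ (haD y hy))
  have hzy : z = h y := ext fun j => hDf j _ _ ((joinedIn_proj hxz j).symm.trans (hxy j)) (by
    rw [qbar_apply, qbar_apply, hz])
  rw [hzy] at hxz
  have := hxz.map h.symm.continuous
  rw [h.symm_apply_apply, h.symm_apply_apply] at this
  refine hU x y (this.mono ?_) (hx.trans hy.symm)
  rintro _ ⟨w, hw, rfl⟩
  exact hDU _ (by rwa [h.apply_symm_apply])

theorem eventually_joinedIn_proj (hD' : IsOpen D') (haD : ∀ x ∈ fiber P a, h x ∈ above P' D')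
    {x : P.Solenoid} (hx : x ∈ fiber P a) (j : ℕ) :
    ∀ᶠ y in 𝓝[fiber P a] x, JoinedIn (P'.qbar j ⁻¹' D') ((h x).1 j) ((h y).1 j) := by
  refine Filter.Eventually.filter_mono nhdsWithin_le_nhds
    (((continuous_proj P' j).comp h.continuous).continuousAt.eventually
      (eventually_joinedIn hD' ?_))
  rw [qbar_apply]
  exact haD x hx

/-- Points of a fibre whose images are in the same plaque of the target at a sufficiently high
level are close. -/
theorem exists_level_proj_eq {U : Set P.Solenoid}
    (hU : ∀ x y : P.Solenoid, JoinedIn U x y → x.1 0 = y.1 0 → x = y) (hD' : IsOpen D')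
    (hDc : IsPathConnected D') (hDf : P'.IsHolonomyFree D') (hDU : ∀ x, h x ∈ above P' D' → x ∈ U)
    (haD : ∀ x ∈ fiber P a, h x ∈ above P' D') (l : ℕ) :
    ∀ᶠ k in Filter.atTop, ∀ x ∈ fiber P a, ∀ y ∈ fiber P a,
      JoinedIn (P'.qbar k ⁻¹' D') ((h x).1 k) ((h y).1 k) → x.1 l = y.1 l := by
  suffices H : ∃ k, ∀ p ∈ fiber P a ×ˢ fiber P a,
      JoinedIn (P'.qbar k ⁻¹' D') ((h p.1).1 k) ((h p.2).1 k) → p.1.1 l = p.2.1 l by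
    obtain ⟨k, hk⟩ := H
    filter_upwards [Filter.eventually_ge_atTop k] with k' hk' x hx y hy hxy
    exact hk (x, y) ⟨hx, hy⟩ (joinedIn_proj_of_le hk' hxy)
  refine ((isCompact_fiber a).prod (isCompact_fiber a)).induction_on
    (p := fun s => ∃ k, ∀ p ∈ s,
      JoinedIn (P'.qbar k ⁻¹' D') ((h p.1).1 k) ((h p.2).1 k) → p.1.1 l = p.2.1 l) ?_ ?_ ?_ ?_
  · exact ⟨0, fun _ h => h.elim⟩
  · rintro s t hst ⟨k, hk⟩
    exact ⟨k, fun p hp => hk p (hst hp)⟩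
  · rintro s t ⟨k, hk⟩ ⟨k', hk'⟩
    refine ⟨max k k', fun p hp hj => hp.elim (fun hp => hk p hp ?_) fun hp => hk' p hp ?_⟩
    · exact joinedIn_proj_of_le (le_max_left _ _) hj
    · exact joinedIn_proj_of_le (le_max_right _ _) hj
  · rintro ⟨x, y⟩ ⟨hx, hy⟩
    simp only at hx hy
    rw [nhdsWithin_prod_eq]
    have hx' := eventually_proj_eq l x
    have hy' := eventually_proj_eq l y
    rw [show x.1 0 = a from hx] at hx'
    rw [show y.1 0 = a from hy] at hy'
    -- Near the diagonal the conclusion holds. Off it, some level puts the images in different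
    -- plaques, and this persists nearby.
    by_cases hxy : x = y
    · refine ⟨_, hx'.prod_mk hy', 0, fun p hp _ => ?_⟩
      rw [hp.1, hp.2, hxy]
    · obtain ⟨k, hk⟩ := not_forall.mp (mt (eq_of_forall_joinedIn hU hDc hDf hDU haD hx hy) hxy)
      refine ⟨_, (eventually_joinedIn_proj hD' haD hx k).prod_mk
        (eventually_joinedIn_proj hD' haD hy k), k, fun p hp hj => ?_⟩
      exact (hk (hp.1.trans (hj.trans hp.2.symm))).elim

/-- The set of plaques of the target which meet the image of a fibre is determined at some
finite level. -/
theorem exists_level_saturated {D : Set (P.M 0)} (hD : IsOpen D) (hDc : IsPathConnected D)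
    (ha : a ∈ D) (hD' : IsOpen D') (hDc' : IsPathConnected D') (hDf : P'.IsHolonomyFree D')
    (hDD : ∀ x ∈ above P D, h x ∈ above P' D') {b : P'.M 0} (hb : b ∈ D') :
    ∃ l, ∀ x ∈ fiber P a, ∀ z ∈ fiber P' b, JoinedIn (P'.qbar l ⁻¹' D') (z.1 l) ((h x).1 l) →
      ∃ y ∈ fiber P a, ∀ k, JoinedIn (P'.qbar k ⁻¹' D') (z.1 k) ((h y).1 k) := by
  have haD : fiber P a ⊆ above P D := fun x hx => show x.1 0 ∈ D from hx ▸ ha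
  refine (isCompact_fiber a).induction_on (p := fun s => ∃ l, ∀ x ∈ s, ∀ z ∈ fiber P' b,
      JoinedIn (P'.qbar l ⁻¹' D') (z.1 l) ((h x).1 l) →
      ∃ y ∈ fiber P a, ∀ k, JoinedIn (P'.qbar k ⁻¹' D') (z.1 k) ((h y).1 k)) ?_ ?_ ?_ ?_
  · exact ⟨0, fun _ h => h.elim⟩
  · rintro s t hst ⟨k, hk⟩
    exact ⟨k, fun p hp => hk p (hst hp)⟩
  · rintro s t ⟨k, hk⟩ ⟨k', hk'⟩
    refine ⟨max k k', fun x hx z hz hj => hx.elim (fun hx => hk x hx z hz ?_)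
      fun hx => hk' x hx z hz ?_⟩
    · exact joinedIn_proj_of_le (le_max_left _ _) hj
    · exact joinedIn_proj_of_le (le_max_right _ _) hj
  · intro x hx
    -- The image of the part over `D` is open, so it contains every point with the level-`l`
    -- coordinate of `h x`. A plaque agreeing with that of `h x` at level `l` thus contains some `h
    -- u` with `u` over `D`, and `u` can be moved over `D` into the fibre over `a`.
    obtain ⟨l, O, -, hxO, hO⟩ := exists_isOpen_proj (x := h x)
      (h.isOpenMap _ (isOpen_above hD)) (mem_image_of_mem h (haD hx))
    refine ⟨_, eventually_joinedIn_proj hD' (fun y hy => hDD y (haD hy)) hx l, l,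
      fun x' hx' z hz hj => ?_⟩
    obtain ⟨w, hw, hzw⟩ := exists_joinedIn (x := z)
      (hDc'.joinedIn _ (show z.1 0 ∈ D' from hz ▸ hb) _ (hDD x (haD hx)))
    have hwx : w.1 l = (h x).1 l := by
      refine hDf l _ _ ((joinedIn_proj hzw l).symm.trans (hj.trans hx'.symm)) ?_
      rw [qbar_apply, qbar_apply, hw]
    obtain ⟨u, hu, rfl⟩ := hO w (hwx ▸ hxO)
    obtain ⟨y, hy, huy⟩ := exists_joinedIn (hDc.joinedIn _ hu _ ha)
    refine ⟨y, hy, fun k => (joinedIn_proj hzw k).trans (joinedIn_proj ?_ k)⟩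
    refine (huy.map h.continuous).mono ?_
    rintro _ ⟨t, ht, rfl⟩
    exact hDD t ht

end Solenoid

end Presentation

/-- A finite set related to a finite set `t` by a map all of whose fibres have the same size has
a cardinality divisible by that of `t`. -/
theorem Set.ncard_dvd_ncard_of_ncard_fiber_le {α β : Type*} {s : Set α} {t : Set β} (hs : s.Finite)
    (ht : t.Finite) {R : α → β → Prop} (hex : ∀ x ∈ s, ∃ y ∈ t, R x y)
    (huniq : ∀ x ∈ s, ∀ y ∈ t, ∀ z ∈ t, R x y → R x z → y = z)
    (hle : ∀ y ∈ t, ∀ z ∈ t, {x ∈ s | R x y}.ncard ≤ {x ∈ s | R x z}.ncard) :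
    t.ncard ∣ s.ncard := by
  classical
  obtain rfl | ⟨y₀, hy₀⟩ := t.eq_empty_or_nonempty
  · have h0 : s = ∅ := eq_empty_of_forall_notMem fun x hx => (hex x hx).elim fun _ h => h.1
    simp [h0]
  have : Nonempty β := ⟨y₀⟩
  choose! f hft hfR using hex
  lift s to Finset α using hs
  lift t to Finset β using ht
  rw [ncard_coe_finset, ncard_coe_finset, Finset.card_eq_sum_card_fiberwise (f := f) (t := t) hft]
  have hc (y) (hy : y ∈ t) : (s.filter fun x => f x = y).card = {x ∈ (s : Set α) | R x y}.ncard := by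
    rw [← ncard_coe_finset]
    congr 1
    ext x
    simp only [Finset.coe_filter, mem_ofPred_eq, Finset.mem_coe]
    exact and_congr_right fun hx => ⟨fun h => h ▸ hfR x hx, huniq x hx _ (hft x hx) _ hy (hfR x hx)⟩
  rw [Finset.sum_congr rfl fun y hy =>
    (hc y hy).trans ((hle y hy y₀ hy₀).antisymm (hle y₀ hy₀ y hy)), Finset.sum_const, smul_eq_mul]
  exact dvd_mul_right _ _

/-! ### Counting plaques and divisibility of degrees -/

namespace Presentation

variable {n : ℕ} {P : Presentation.{u} n}

theorem degreeProd_dvd_succ (l : ℕ) : P.degreeProd l ∣ P.degreeProd (l + 1) :=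
  ⟨_, P.degreeProd_succ l⟩

namespace Solenoid

/-- Every two points of a fibre of `P.qbar j` are related by transport along a closed path, which
extends to the fibre of the solenoid. -/
theorem exists_transport {a : P.M 0} {j : ℕ} {c d : P.M j} (hc : P.qbar j c = a)
    (hd : P.qbar j d = a) :
    ∃ L : C(I × fiber P a, P.Solenoid), (∀ x, L (0, x) = x) ∧ (∀ x, L (1, x) ∈ fiber P a) ∧
      (∀ x : fiber P a, x.1.1 j = c → (L (1, x)).1 j = d) ∧
      ∀ (k : ℕ) (x y : fiber P a), (L (1, x)).1 k = (L (1, y)).1 k → x.1.1 k = y.1.1 k := by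
  let Γ := PathConnectedSpace.somePath c d
  have hΓ : Continuous fun t => P.qbar j (Γ t) := (P.continuous_qbar j).comp Γ.continuous
  obtain ⟨L, hL, hL0⟩ := exists_lift_homotopy (P := P) (A := fiber P a)
    ⟨fun t => P.qbar j (Γ t.1), hΓ.comp continuous_fst⟩ ⟨Subtype.val, continuous_subtype_val⟩
    (fun x => by simp only [ContinuousMap.coe_mk, Γ.source]; exact hc.trans (Eq.symm x.2))
  have hL0 (x : fiber P a) : L (0, x) = x := hL0 x
  refine ⟨L, hL0, fun x => ?_, fun x hx => ?_, fun k x y hxy => ?_⟩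
  · change (L (1, x)).1 0 = a
    simp [hL, hd]
  · have := congr_fun ((P.isCoveringMap_qbar j).eq_of_comp_eq (g₁ := fun t : I => (L (t, x)).1 j)
      (g₂ := Γ) ((continuous_proj P j).comp (by fun_prop)) Γ.continuous (funext fun t => ?_) 0
      (by simp [hL0, hx])) 1
    · exact this.trans Γ.target
    · simp only [Function.comp_apply, qbar_apply, hL]
      rfl
  · have := proj_eq_of_lifts (F := fun t : I => L (t, x)) (G := fun t => L (t, y)) (by fun_prop)
      (by fun_prop) (fun t => (hL (t, x)).trans (hL (t, y)).symm) hxy 0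
    rwa [hL0, hL0] at this

variable {n' : ℕ} {P' : Presentation.{v} n'} (h : P.Solenoid ≃ₜ P'.Solenoid)
  (a : P.M 0) (D' : Set (P'.M 0)) (b : P'.M 0)

/-- The points of the fibre over `b` of the `j`-th manifold of the target which are in the plaque
over `D'` of the image of a point of the fibre over `a` in `s`. -/
def plaques (s : Set P.Solenoid) (j : ℕ) : Set (P'.M j) :=
  {c | P'.qbar j c = b ∧
    ∃ x ∈ fiber P a ∩ s, JoinedIn (P'.qbar j ⁻¹' D') c ((h x).1 j)}

variable {h a D' b}

theorem finite_plaques (s : Set P.Solenoid) (j : ℕ) : (plaques h a D' b s j).Finite :=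
  (P'.finite_fiber_qbar j b).subset fun _ hc => hc.1

/-- Passing to another plaque over `D'` in the solenoid. -/
theorem exists_mem_plaques (hDc : IsPathConnected D') (hb : b ∈ D')
    (haD : ∀ x ∈ fiber P a, h x ∈ above P' D') {x : P.Solenoid} (hx : x ∈ fiber P a) (j : ℕ) :
    ∃ c, P'.qbar j c = b ∧ JoinedIn (P'.qbar j ⁻¹' D') c ((h x).1 j) := by
  obtain ⟨z, hz, hxz⟩ := exists_joinedIn (hDc.joinedIn _ (haD x hx) _ hb)
  exact ⟨z.1 j, (P'.qbar_apply z j).trans hz, (joinedIn_proj hxz j).symm⟩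

/-- At high levels, the number of plaques is multiplied by the degrees. -/
theorem exists_ncard_plaques_mul {D : Set (P.M 0)} (hD : IsOpen D) (hDc : IsPathConnected D)
    (ha : a ∈ D) (hD' : IsOpen D') (hDc' : IsPathConnected D') (hDf : P'.IsHolonomyFree D')
    (hDD : ∀ x ∈ above P D, h x ∈ above P' D') (hb : b ∈ D') :
    ∃ l, ∀ k, l ≤ k → (plaques h a D' b univ k).ncard * P'.degreeProd l =
      (plaques h a D' b univ l).ncard * P'.degreeProd k := by
  obtain ⟨l, hl⟩ := exists_level_saturated hD hDc ha hD' hDc' hDf hDD hb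
  refine ⟨l, fun k hk => ?_⟩
  induction k, hk using Nat.le_induction with
  | base => rfl
  | succ k hk ih =>
    have : plaques h a D' b univ (k + 1) = P'.q k ⁻¹' plaques h a D' b univ k := by
      ext c
      obtain ⟨z, rfl⟩ := exists_proj_eq P' (k + 1) c
      rw [mem_preimage, z.2 k]
      constructor
      · rintro ⟨hc, x, hx, hj⟩
        refine ⟨?_, x, hx, joinedIn_proj_of_le k.le_succ hj⟩
        rwa [qbar_apply] at hc ⊢
      · rintro ⟨hc, x, hx, hj⟩
        rw [qbar_apply] at hc
        obtain ⟨y, hy, hzy⟩ := hl x hx.1 z hc (joinedIn_proj_of_le hk hj)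
        exact ⟨(P'.qbar_apply z _).trans hc, y, ⟨hy, trivial⟩, hzy (k + 1)⟩
    rw [this, P'.ncard_preimage_q k (finite_plaques _ _), degreeProd_succ, mul_right_comm, ih,
      mul_assoc]

/-- The number of plaques meeting the image of a cylinder in a fibre depends only on the level of
the cylinder. -/
theorem eventually_ncard_plaques_le {U : Set P.Solenoid}
    (hU : ∀ x y : P.Solenoid, JoinedIn U x y → x.1 0 = y.1 0 → x = y) (hD' : IsOpen D')
    (hDc : IsPathConnected D') (hDf : P'.IsHolonomyFree D') (hDU : ∀ x, h x ∈ above P' D' → x ∈ U)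
    (haD : ∀ x ∈ fiber P a, h x ∈ above P' D') (hb : b ∈ D') {j : ℕ} {c d : P.M j}
    (hc : P.qbar j c = a) (hd : P.qbar j d = a) :
    ∀ᶠ k in Filter.atTop, (plaques h a D' b {x | x.1 j = c} k).ncard ≤
      (plaques h a D' b {x | x.1 j = d} k).ncard := by
  obtain ⟨L, hL0, hL1, hLj, hLk⟩ := exists_transport hc hd
  obtain ⟨m, hm⟩ := exists_level_joinedIn_iff h hD' hDf haD L hL0 hL1
  -- From level `m` on, transport respects plaques; `k` is so large that points of the fibre in one
  -- level-`k` plaque agree at level `m`.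
  filter_upwards [exists_level_proj_eq hU hD' hDc hDf hDU haD m] with k hk
  have hex : ∀ e ∈ plaques h a D' b {x | x.1 j = c} k, ∃ x : fiber P a, x.1.1 j = c ∧
      JoinedIn (P'.qbar k ⁻¹' D') e ((h x).1 k) ∧ ∃ e', P'.qbar k e' = b ∧
      JoinedIn (P'.qbar k ⁻¹' D') e' ((h (L (1, x))).1 k) := by
    rintro e ⟨-, x, ⟨hx, hxc⟩, hj⟩
    exact ⟨⟨x, hx⟩, hxc, hj, exists_mem_plaques hDc hb haD (hL1 _) k⟩
  have : Nonempty (fiber P a) := by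
    obtain ⟨x, hx⟩ := exists_proj_eq P 0 a
    exact ⟨⟨x, hx⟩⟩
  choose! x hxc hxe f hfb hfj using hex
  refine ncard_le_ncard_of_injOn f (fun e he => ⟨hfb e he, L (1, x e), ⟨hL1 _, hLj _ (hxc e he)⟩,
    hfj e he⟩) (fun e he e' he' hee => ?_) (finite_plaques _ _)
  -- If the end points share a plaque, they agree at level `m`, hence so do the starting points, and
  -- the plaque relation can be carried back.
  have hj := (hfj e he).symm.trans (hee ▸ hfj e' he')
  have hj' := (hm _ _ (hLk m _ _ (hk _ (hL1 _) _ (hL1 _) hj)) k).mpr hj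
  exact hDf k _ _ ((hxe e he).trans (hj'.trans (hxe e' he').symm)) (he.1.trans he'.1.symm)

/-- If small plaques in the source are mapped into small plaques in the target by a
homeomorphism of solenoids, then the degrees of the source divide those of the target, up to a
constant. -/
theorem exists_degreeProd_dvd_of_plaques {U : Set P.Solenoid}
    (hU : ∀ x y : P.Solenoid, JoinedIn U x y → x.1 0 = y.1 0 → x = y) {D : Set (P.M 0)}
    (hD : IsOpen D) (hDc : IsPathConnected D) (hD' : IsOpen D') (hDc' : IsPathConnected D')
    (hDf : P'.IsHolonomyFree D') (hDU : ∀ x, h x ∈ above P' D' → x ∈ U)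
    (hDD : ∀ x ∈ above P D, h x ∈ above P' D') :
    ∃ A, 0 < A ∧ ∀ j, ∃ k, P.degreeProd j ∣ A * P'.degreeProd k := by
  obtain ⟨a, ha⟩ := hDc.nonempty
  obtain ⟨b, hb⟩ := hDc'.nonempty
  have haD : ∀ x ∈ fiber P a, h x ∈ above P' D' := fun x hx =>
    hDD x (show x.1 0 ∈ D from hx ▸ ha)
  obtain ⟨l, hl⟩ := exists_ncard_plaques_mul (h := h) hD hDc ha hD' hDc' hDf hDD hb
  obtain ⟨x, hx⟩ := exists_proj_eq P 0 a
  obtain ⟨c, hc, hcx⟩ := exists_mem_plaques hDc' hb haD hx l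
  refine ⟨(plaques h a D' b univ l).ncard, ?_, fun j => ?_⟩
  · exact (ncard_pos (finite_plaques _ _)).mpr ⟨c, hc, x, ⟨hx, trivial⟩, hcx⟩
  have hfin := P.finite_fiber_qbar j a
  have hev : ∀ᶠ k in Filter.atTop, ∀ c ∈ P.qbar j ⁻¹' {a}, ∀ d ∈ P.qbar j ⁻¹' {a},
      (plaques h a D' b {x | x.1 j = c} k).ncard ≤ (plaques h a D' b {x | x.1 j = d} k).ncard :=
    (Filter.eventually_all_finite hfin).mpr fun c hc => (Filter.eventually_all_finite hfin).mpr
      fun d hd => eventually_ncard_plaques_le hU hD' hDc' hDf hDU haD hb hc hd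
  obtain ⟨k, hle, hk, hlk⟩ := (hev.and ((exists_level_proj_eq hU hD' hDc' hDf hDU haD j).and
    (Filter.eventually_ge_atTop l))).exists
  have hsep (c : P.M j) : {e ∈ plaques h a D' b univ k | e ∈ plaques h a D' b {x | x.1 j = c} k} =
      plaques h a D' b {x | x.1 j = c} k := by
    refine inter_eq_right.mpr fun e he => ⟨he.1, ?_⟩
    obtain ⟨x, hx, hxe⟩ := he.2
    exact ⟨x, ⟨hx.1, trivial⟩, hxe⟩
  have hdvd : (P.qbar j ⁻¹' {a}).ncard ∣ (plaques h a D' b univ k).ncard := by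
    refine ncard_dvd_ncard_of_ncard_fiber_le (finite_plaques _ _) hfin
      (R := fun e c => e ∈ plaques h a D' b {x | x.1 j = c} k) ?_ ?_ ?_
    · rintro e ⟨he, x, ⟨hx, -⟩, hj⟩
      exact ⟨x.1 j, (P.qbar_apply x j).trans hx, he, x, ⟨hx, rfl⟩, hj⟩
    · rintro e - c - d - ⟨-, x, ⟨hx, rfl⟩, hex⟩ ⟨-, y, ⟨hy, rfl⟩, hey⟩
      exact hk x hx y hy (hex.symm.trans hey)
    · intro c hc d hd
      rw [hsep, hsep]
      exact hle c hc d hd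
  rw [P.ncard_fiber_qbar] at hdvd
  exact ⟨k, (hdvd.mul_right _).trans (hl k hlk).dvd⟩

end Solenoid

/-- Finitely many manifolds of a presentation can be deleted, to replace an open set at some level
by an open set at level zero. -/
theorem exists_shift : ∀ (l : ℕ) {n : ℕ} (P : Presentation.{u} n) {O : Set (P.M l)}, IsOpen O →
    ∃ (Q : Presentation.{u} n) (e : Q.Solenoid ≃ₜ P.Solenoid) (V : Set (Q.M 0)), IsOpen V ∧
      (∀ y, y.1 0 ∈ V ↔ (e y).1 l ∈ O) ∧ (∀ y z, y.1 0 = z.1 0 → (e y).1 0 = (e z).1 0) ∧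
      (∃ c, 0 < c ∧ ∀ j, P.degreeProd j ∣ c * Q.degreeProd j) ∧
      ∀ j, ∃ k, Q.degreeProd j ∣ P.degreeProd k
  | 0, _, P, O, hO => ⟨P, Homeomorph.refl _, O, hO, fun _ => Iff.rfl, fun _ _ h => h,
      ⟨1, one_pos, fun j => by rw [one_mul]⟩, fun j => ⟨j, dvd_rfl⟩⟩
  | l + 1, _, P, O, hO => by
    obtain ⟨Q, e, V, hV, hVO, he, ⟨c, hc, hPQ⟩, hQP⟩ := exists_shift l P.shift (O := O) hO
    refine ⟨Q, e.trans P.shiftHomeomorph, V, hV, hVO, fun y z hyz => ?_,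
      ⟨P.degree 0 * c, Nat.mul_pos (P.degree_pos 0) hc, fun j => ?_⟩, fun j => ?_⟩
    · exact congrArg (P.q 0) (he y z hyz)
    -- Passing to `j + 1` factors compensates for the deleted factor `P.degree 0`.
    · refine (degreeProd_dvd_succ j).trans ?_
      rw [degreeProd_succ', mul_assoc]
      exact mul_dvd_mul_left _ (hPQ j)
    · obtain ⟨k, hk⟩ := hQP j
      exact ⟨k + 1, hk.trans (P.degreeProd_succ' k ▸ dvd_mul_left _ _)⟩

/-- The degrees of presentations of homeomorphic solenoids divide each other, up to constants. -/
theorem exists_degreeProd_dvd {n' : ℕ} {P' : Presentation.{v} n'}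
    (h : P.Solenoid ≃ₜ P'.Solenoid) :
    ∃ A, 0 < A ∧ ∀ j, ∃ k, P.degreeProd j ∣ A * P'.degreeProd k := by
  obtain ⟨x, -⟩ := Solenoid.exists_proj_eq P 0 (Classical.arbitrary _)
  -- The sets are nested: `D'` is chosen so that `h⁻¹` maps the part over it into the part over
  -- `D₁`, then `D` so that `h` maps the part over it into the part over `D'`. Deleting levels
  -- brings `D` and `D'` to level zero.
  obtain ⟨D₁, -, hD₁, hxD₁, -, hD₁f⟩ := P.exists_isHolonomyFree isOpen_univ (mem_univ (x.1 0))
  obtain ⟨l', O', hO', hxO', hO'U⟩ := Solenoid.exists_isOpen_proj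
    (h.isOpenMap _ (Solenoid.isOpen_above hD₁)) (mem_image_of_mem h hxD₁)
  obtain ⟨Q', e', V', hV', hVO', -, -, hQP'⟩ := exists_shift l' P' hO'
  obtain ⟨D', hDV', hD', hxD', hDc', hDf'⟩ := Q'.exists_isHolonomyFree (y := (e'.symm (h x)).1 0)
    hV' (by rwa [hVO', e'.apply_symm_apply])
  obtain ⟨l, O, hO, hxO, hOU⟩ := Solenoid.exists_isOpen_proj
    ((Solenoid.isOpen_above hD').preimage (h.trans e'.symm).continuous) (show x ∈ _ from hxD')
  obtain ⟨Q, e, V, hV, hVO, he, ⟨c, hc, hPQ⟩, -⟩ := exists_shift l P hO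
  obtain ⟨D, hDV, hD, -, hDc, -⟩ := Q.exists_isHolonomyFree (y := (e.symm x).1 0)
    hV (by rwa [hVO, e.apply_symm_apply])
  have hU : ∀ y z : Q.Solenoid, JoinedIn (e ⁻¹' Solenoid.above P D₁) y z → y.1 0 = z.1 0 →
      y = z := by
    intro y z hyz hyz0
    have hj : JoinedIn (Solenoid.above P D₁) (e y) (e z) :=
      (hyz.map e.continuous).mono (image_preimage_subset _ _)
    refine e.injective (Solenoid.ext fun l => hD₁f l _ _ (Solenoid.joinedIn_proj hj l) ?_)
    rw [qbar_apply, qbar_apply, he y z hyz0]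
  obtain ⟨A, hA, hdvd⟩ := Solenoid.exists_degreeProd_dvd_of_plaques
    (h := e.trans (h.trans e'.symm)) hU hD hDc hD' hDc' hDf' (fun y hy => by
      obtain ⟨w, hw, hwy⟩ := hO'U (h (e y)) (by simpa using (hVO' _).mp (hDV' hy))
      obtain rfl := h.injective hwy
      exact hw) fun y hy => hOU _ ((hVO y).mp (hDV hy))
  refine ⟨c * A, Nat.mul_pos hc hA, fun j => ?_⟩
  obtain ⟨k, hk⟩ := hdvd j
  obtain ⟨k', hk'⟩ := hQP' k
  exact ⟨k', (hPQ j).trans (mul_assoc c A _ ▸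
    mul_dvd_mul_left c (hk.trans (mul_dvd_mul_left A hk')))⟩

end Presentation

/-! ### Arithmetic of Steinitz numbers -/

namespace SteinitzNumber

/-- The integer is the product of `p ^ f p` over `s`; it serves to correct finitely many exponents.
-/
theorem exists_χ_eq (s : Finset Nat.Primes) (f : Nat.Primes → ℕ) :
    ∃ m : ℕ, 1 ≤ m ∧ ∀ p, (ofNat m).χ p = if p ∈ s then (f p : ℕ∞) else 0 := by
  classical
  induction s using Finset.induction_on with
  | empty => exact ⟨1, le_rfl, fun p => emultiplicity_of_one_right p.2.not_isUnit⟩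
  | insert q s hq ih =>
    obtain ⟨m, hm, h⟩ := ih
    refine ⟨m * q ^ f q, Nat.mul_pos hm (Nat.pow_pos q.2.pos), fun p => ?_⟩
    rw [ofNat_mul, mul_χ, h]
    by_cases hpq : p = q
    · subst hpq
      simp only [hq, if_false, zero_add, Finset.mem_insert_self, if_true]
      exact emultiplicity_pow_self_of_prime p.2.prime _
    · have : (ofNat ((q : ℕ) ^ f q)).χ p = 0 := emultiplicity_eq_zero.mpr fun hd =>
        hpq (Subtype.ext ((Nat.prime_dvd_prime_iff_eq p.2 q.2).mp (p.2.dvd_of_dvd_pow hd)))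
      simp [this, Finset.mem_insert, hpq]

/-- Steinitz numbers which divide each other up to positive integers are asymptotically
equivalent. -/
theorem asympEquiv_of_le {ξ η : SteinitzNumber} {a b : ℕ} (ha : 0 < a) (hb : 0 < b)
    (hξ : ∀ p, ξ.χ p ≤ (ofNat a).χ p + η.χ p) (hη : ∀ p, η.χ p ≤ (ofNat b).χ p + ξ.χ p) :
    AsympEquiv ξ η := by
  classical
  have hfin {c : ℕ} (hc : 0 < c) (p : Nat.Primes) : (ofNat c).χ p ≠ ⊤ :=
    finiteMultiplicity_iff_emultiplicity_ne_top.mp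
      (Nat.finiteMultiplicity_iff.mpr ⟨p.2.ne_one, hc⟩)
  have htop (p : Nat.Primes) : ξ.χ p = ⊤ ↔ η.χ p = ⊤ := by
    constructor
    · intro h
      have := hξ p
      rw [h, top_le_iff, ENat.add_eq_top] at this
      exact this.resolve_left (hfin ha p)
    · intro h
      have := hη p
      rw [h, top_le_iff, ENat.add_eq_top] at this
      exact this.resolve_left (hfin hb p)
  have hs : {p : Nat.Primes | (p : ℕ) ∣ a * b}.Finite :=
    Set.Finite.preimage (f := Subtype.val) Subtype.val_injective.injOn
      ((Set.finite_le_nat (a * b)).subset fun p hp => Nat.le_of_dvd (Nat.mul_pos ha hb) hp)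
  -- At the primes dividing `a * b`, multiplying each number by the exponents of the other makes
  -- both sides the same sum. Infinite exponents occur in both numbers at once, so the default
  -- `toNat ⊤ = 0` does no harm.
  obtain ⟨m, hm, hmχ⟩ := exists_χ_eq hs.toFinset fun p => (η.χ p).toNat
  obtain ⟨m', hm', hmχ'⟩ := exists_χ_eq hs.toFinset fun p => (ξ.χ p).toNat
  refine ⟨m, m', hm, hm', SteinitzNumber.ext (funext fun p => ?_)⟩
  rw [mul_χ, mul_χ, hmχ, hmχ']
  by_cases hp : (p : ℕ) ∣ a * b
  · rw [if_pos (by simpa using hp), if_pos (by simpa using hp)]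
    by_cases hpt : ξ.χ p = ⊤
    · rw [hpt, (htop p).mp hpt, add_top]
    · rw [ENat.natCast_toNat hpt, ENat.natCast_toNat (mt (htop p).mpr hpt), add_comm]
  · have h₁ : (ofNat a).χ p = 0 := emultiplicity_eq_zero.mpr fun h => hp (h.mul_right b)
    have h₂ : (ofNat b).χ p = 0 := emultiplicity_eq_zero.mpr fun h => hp (h.mul_left a)
    rw [if_neg (by simpa using hp), if_neg (by simpa using hp)]
    congr 1
    exact le_antisymm (by simpa [h₁] using hξ p) (by simpa [h₂] using hη p)

end SteinitzNumber

namespace Presentation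

theorem steinitz_χ_le {n n' : ℕ} {P : Presentation.{u} n} {P' : Presentation.{v} n'} {A : ℕ}
    (h : ∀ j, ∃ k, P.degreeProd j ∣ A * P'.degreeProd k) (p : Nat.Primes) :
    P.steinitz.χ p ≤ (SteinitzNumber.ofNat A).χ p + P'.steinitz.χ p := by
  refine iSup₂_le ?_
  rintro _ ⟨j, -, rfl⟩
  obtain ⟨k, hk⟩ := h j
  -- The lcm ranges over positive levels only, and `k` may be zero.
  have hdvd : P.degreeProd j ∣ A * P'.degreeProd (k + 1) :=
    hk.trans (mul_dvd_mul_left A (degreeProd_dvd_succ k))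
  refine (emultiplicity_le_emultiplicity_of_dvd_right hdvd).trans ?_
  rw [emultiplicity_mul p.2.prime]
  refine add_le_add le_rfl ?_
  exact le_iSup₂ (f := fun m (_ : m ∈ {d | ∃ l, 0 < l ∧ d = P'.degreeProd l}) =>
    (SteinitzNumber.ofNat m).χ p) (P'.degreeProd (k + 1)) ⟨k + 1, k.succ_pos, rfl⟩

theorem type_steinitz_eq {n n' : ℕ} {P : Presentation.{u} n} {P' : Presentation.{v} n'}
    (h : P.Solenoid ≃ₜ P'.Solenoid) : P.steinitz.type = P'.steinitz.type := by
  obtain ⟨a, ha, hPP'⟩ := exists_degreeProd_dvd h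
  obtain ⟨b, hb, hP'P⟩ := exists_degreeProd_dvd h.symm
  exact Quotient.sound (s := SteinitzNumber.asympSetoid) (SteinitzNumber.asympEquiv_of_le ha hb
    (steinitz_χ_le hPP') (steinitz_χ_le hP'P))

end Presentation

theorem theorem7p3 :
    -- the Steinitz number is well defined: the covering degrees are positive integers that do not
    -- depend on a choice of point, the composite coverings have the product degrees, and for each
    -- choice of a basepoint of the solenoid the number is the lcm of the indices of the group chain
    (∀ (n : ℕ) (P : Presentation.{u} n),
      (∀ (l : ℕ), 0 < P.degree l ∧ ∀ y : P.M l, Nat.card (P.q l ⁻¹' {y}) = P.degree l) ∧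
      (∀ (l : ℕ) (y : P.M 0), Nat.card (P.qbar l ⁻¹' {y}) = P.degreeProd l) ∧
      (∀ x : P.Solenoid,
        (∀ l : ℕ, (P.groupChain x l).index = P.degreeProd l) ∧
        P.steinitz = SteinitzNumber.lcm {d | ∃ l, 0 < l ∧ d = (P.groupChain x l).index})) ∧
    -- its type depends only on the homeomorphism class of the solenoid
    (∀ (n n' : ℕ) (P : Presentation.{u} n) (P' : Presentation.{v} n'),
      Nonempty (P.Solenoid ≃ₜ P'.Solenoid) → P.steinitz.type = P'.steinitz.type) := by
  refine ⟨fun n P => ⟨fun l => ⟨P.degree_pos l, P.nat_card_fiber_q l⟩, fun l y => ?_,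
    fun x => ⟨P.index_groupChain x, ?_⟩⟩, fun n n' P P' ⟨h⟩ => Presentation.type_steinitz_eq h⟩
  · rw [Nat.card_coe_set_eq, P.ncard_fiber_qbar]
  · simp only [P.index_groupChain]
    rfl
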